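/- There are a deterministic CONGEST algorithm $\mathcal A$ and an absolute constant $C$ such that, for every integer $\alpha \ge 1$ and every finite simple graph $G$ on $n$ vertices whose edge set is the union of at most $\alpha$ forests (that is, of arboricity at most $\alpha$), the algorithm $\mathcal A$, run on $G$ as the communication network, terminates at all vertices within at most $C \log n$ rounds and outputs a dominating set $S$ of $G$ with $|S| \le C\alpha^2 |D|$ for every dominating set $D$ of $G$; that is, $S$ is an $O(\alpha^2)$-approximation of a minimum dominating set. Here the CONGEST model is the following. Every vertex is a processor; it initially knows only $n$, $\alpha$, its degree and its own identifier. The identifiers are arbitrary distinct elements of $\{0, \dots, n^c - 1\}$ for a fixed $c$, and the incident edges of each vertex are numbered arbitrarily. In each synchronous round every vertex sends to each of its neighbours a message of at most $B \log n$ bits, where $B$ depends only on $c$, receives the messages of its neighbours, and performs an arbitrary deterministic local computation. When a vertex stops, it irrevocably outputs whether it belongs to $S$, and it sends nothing afterwards. -/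

import Mathlib

/-- The arboricity of `G` is at most `a`: the edge set of `G` is the union of the edge sets of `a`
forests on the vertex set of `G`. -/
def HasArboricityAtMost {V : Type*} (G : SimpleGraph V) (a : ℕ) : Prop :=
  ∃ F : Fin a → SimpleGraph V, (∀ i, (F i).IsAcyclic) ∧ ⨆ i, F i = G

/-- `D` is a dominating set of `G`: the closed neighbourhood of `D` is the whole vertex set. -/
def IsDominatingSet {V : Type*} (G : SimpleGraph V) (D : Finset V) : Prop :=
  ∀ v, v ∈ D ∨ ∃ u ∈ D, G.Adj u v

/-- What an input of the message passing model consists of besides the graph: distinct identifiers,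
and at every vertex a numbering of its incident links (the ports `0, …, deg v - 1`). Both are
arbitrary; in particular the numberings at the two ends of a link are unrelated. -/
structure Network {V : Type*} (G : SimpleGraph V) [G.LocallyFinite] where
  id : V → ℕ
  id_injective : Function.Injective id
  port : (v : V) → Fin (G.degree v) ≃ G.neighborSet v

/-- A deterministic synchronous message passing algorithm, the same for all vertices and all graphs.
Messages are bit strings, and the empty string stands for no message. Local computation is
unrestricted. -/
structure DistributedAlgorithm where
  /-- The possible local states of a processor. -/
  State : Type
  /-- The initial state of a processor, which knows the number `n` of processors, a parameter `a`
  common to all processors, its own identifier and its own degree, and nothing else. -/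
  init : (n a ident degree : ℕ) → State
  /-- The bit string that a processor sends through the port of the given number. -/
  send : State → ℕ → List Bool
  /-- The next state, given the list of received messages (entry `p` came in through port `p`). -/
  step : State → List (List Bool) → State
  /-- `none` while the processor is running; `some b` once it has stopped with output `b`. -/
  output : State → Option Bool

namespace DistributedAlgorithm

/-- The bit string that a processor in state `s` puts on port `p`: nothing once it has stopped. -/
def emit (A : DistributedAlgorithm) (s : A.State) (p : ℕ) : List Bool :=
  if (A.output s).isSome then [] else A.send s p

variable {V : Type*} [Fintype V] {G : SimpleGraph V} [DecidableRel G.Adj]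

/-- The messages that `v` receives in a round which the vertices enter in the states `σ`. -/
def inbox (A : DistributedAlgorithm) (N : Network G) (σ : V → A.State) (v : V) :
    List (List Bool) :=
  List.ofFn fun p : Fin (G.degree v) =>
    A.emit (σ (N.port v p)) ((N.port (N.port v p)).symm ⟨v, (N.port v p).2.symm⟩)

/-- The state of every vertex after `t` rounds, the common parameter being `a`. In each round all
vertices send, then all receive, then all that have not stopped update their state. -/
def stateAfter (A : DistributedAlgorithm) (N : Network G) (a : ℕ) : ℕ → V → A.State
  | 0 => fun v => A.init (Fintype.card V) a (N.id v) (G.degree v)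
  | t + 1 => fun v =>
      if (A.output (A.stateAfter N a t v)).isSome then A.stateAfter N a t v
      else A.step (A.stateAfter N a t v) (A.inbox N (A.stateAfter N a t) v)

/-- The message that `v` sends through its port `p` in round `t + 1`. -/
def message (A : DistributedAlgorithm) (N : Network G) (a t : ℕ) (v : V) (p : Fin (G.degree v)) :
    List Bool :=
  A.emit (A.stateAfter N a t v) p

/-- After `T` rounds every vertex has stopped, and the vertices with output `true` are exactly the
elements of `S`. -/
def ComputesWithin (A : DistributedAlgorithm) (N : Network G) (a T : ℕ) (S : Finset V) : Prop :=
  ∀ v, ∃ b : Bool, A.output (A.stateAfter N a T v) = some b ∧ (b = true ↔ v ∈ S)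

end DistributedAlgorithm

open Finset

/-! The proof is primal-dual. If every closed neighbourhood has weight at most `M = 2 ^ k`, the
total weight is at most `M * |D|` for each dominating set `D`
(`sum_le_mul_card_of_isDominatingSet`). Weights start at 1, where `n ≤ M` suffices; half full
vertices are chosen and uncovered ones double. Stopping when the weights can reach about `M / a`
makes both parts of the output small. An uncovered vertex has weight at least `M / (16 * a)`. A
chosen vertex sees weight `M / 2`, at most half of it on itself and its out-neighbours in an
orientation of out-degree at most `a`; so in-neighbours carry `M / 4`, and each vertex is an
in-neighbour of at most `a` others (`card_mul_le_of_half_full`). This gives the factor `20 * a`,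
linear in the arboricity (`card_primalDualSet_le`). Exponents stay `O(log n)`, hence can be sent in
unary. -/

theorem Finset.sum_union_le_add {ι : Type*} [DecidableEq ι] (s t : Finset ι) (w : ι → ℕ) :
    ∑ x ∈ s ∪ t, w x ≤ ∑ x ∈ s, w x + ∑ x ∈ t, w x :=
  sum_union_inter (f := w) ▸ Nat.le_add_right _ _

theorem Finset.sum_biUnion_le_sum {ι κ : Type*} [DecidableEq ι] (s : Finset κ) (t : κ → Finset ι)
    (w : ι → ℕ) : ∑ x ∈ s.biUnion t, w x ≤ ∑ i ∈ s, ∑ x ∈ t i, w x := by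
  classical
  induction s using Finset.induction_on with
  | empty => simp
  | insert i s hi ih =>
    rw [biUnion_insert, sum_insert hi]
    exact (sum_union_le_add _ _ w).trans (Nat.add_le_add_left ih _)

/-! ### Orientations of small out-degree -/

/-- A forest can be oriented so that every vertex has at most one out-neighbour, its parent. -/
theorem SimpleGraph.IsAcyclic.exists_parent {V : Type*} {F : SimpleGraph V} (hF : F.IsAcyclic) :
    ∃ f : V → V, ∀ u v, F.Adj u v → f u = v ∨ f v = u := by
  classical
  have hroot : ∀ v, F.Reachable (F.connectedComponentMk v).out v := fun v =>
    SimpleGraph.ConnectedComponent.exact (Quot.out_eq _)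
  choose p hp using fun v => (hroot v).exists_isPath
  refine ⟨fun v => (p v).penultimate, fun u v huv => ?_⟩
  -- The parent is the penultimate vertex on the path from the root. Either `v` precedes `u` on the
  -- path to `u`, or `u` precedes `v` on the path to `v`. The start `r` is general because the two
  -- roots are only propositionally equal.
  have key : ∀ r (q : F.Walk r u), q.IsPath → q.penultimate = v ∨ (p v).penultimate = u ∨
      r ≠ (F.connectedComponentMk v).out := by
    intro r q hq
    by_cases hr : r = (F.connectedComponentMk v).out
    · subst hr
      by_cases hv : v ∈ q.support
      · exact Or.inl (hF.eq_penultimate_of_adj_end hq huv hv).symm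
      · exact Or.inr (Or.inl (hF.eq_penultimate_of_adj_end (hp v) huv.symm
          (hF.mem_support_of_ne_mem_support_of_adj_of_isPath (hp v) hq huv.symm hv)).symm)
    · exact Or.inr (Or.inr hr)
  rcases key _ (p u) (hp u) with h | h | h
  · exact Or.inl h
  · exact Or.inr h
  · exact absurd (by rw [SimpleGraph.ConnectedComponent.sound huv.reachable]) h

/-- A graph of arboricity at most `a` has an orientation with out-degrees at most `a`. -/
theorem HasArboricityAtMost.exists_orientation {V : Type*} {G : SimpleGraph V} {a : ℕ}
    (h : HasArboricityAtMost G a) :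
    ∃ f : Fin a → V → V, ∀ u v, G.Adj u v → (∃ i, f i u = v) ∨ ∃ i, f i v = u := by
  obtain ⟨F, hF, rfl⟩ := h
  choose f hf using fun i => (hF i).exists_parent
  refine ⟨f, fun u v huv => ?_⟩
  obtain ⟨i, hi⟩ := SimpleGraph.iSup_adj.1 huv
  exact (hf i u v hi).imp (fun h => ⟨i, h⟩) fun h => ⟨i, h⟩

/-! ### Fractional packings and the two counting bounds -/

section Weights

variable {V : Type*} [Fintype V] {G : SimpleGraph V} [DecidableRel G.Adj]

/-- The total weight of the closed neighbourhood of `v`. -/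
def closedNbhdSum (G : SimpleGraph V) [DecidableRel G.Adj] (w : V → ℕ) (v : V) : ℕ :=
  w v + ∑ u ∈ G.neighborFinset v, w u

theorem closedNbhdSum_mono {w w' : V → ℕ} (h : ∀ u, w u ≤ w' u) (v : V) :
    closedNbhdSum G w v ≤ closedNbhdSum G w' v :=
  add_le_add (h v) (sum_le_sum fun u _ => h u)

/-- Weak duality: a fractional packing of closed neighbourhoods is at most a dominating set. -/
theorem sum_le_mul_card_of_isDominatingSet {w : V → ℕ} {M : ℕ}
    (hM : ∀ v, closedNbhdSum G w v ≤ M) {D : Finset V} (hD : IsDominatingSet G D) :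
    ∑ v, w v ≤ M * D.card := by
  classical
  calc ∑ v, w v ≤ ∑ v ∈ D.biUnion fun u => insert u (G.neighborFinset u), w v := by
        refine sum_le_sum_of_subset fun v _ => ?_
        rw [mem_biUnion]
        rcases hD v with h | ⟨u, hu, huv⟩
        · exact ⟨v, h, mem_insert_self _ _⟩
        · exact ⟨u, hu, mem_insert_of_mem (by simpa using huv)⟩
    _ ≤ ∑ u ∈ D, ∑ v ∈ insert u (G.neighborFinset u), w v := sum_biUnion_le_sum _ _ _
    _ = ∑ u ∈ D, closedNbhdSum G w u :=
        sum_congr rfl fun u _ => sum_insert (by simp)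
    _ ≤ D.card • M := sum_le_card_nsmul _ _ _ fun u _ => hM u
    _ = M * D.card := by rw [smul_eq_mul, mul_comm]

/-- Vertices whose closed neighbourhoods are half full, while single weights are small, are few. -/
theorem card_mul_le_of_half_full {a L M : ℕ} (ha : 1 ≤ a) (hG : HasArboricityAtMost G a)
    {w : V → ℕ} (hw : ∀ v, w v ≤ L) (hL : 8 * a * L ≤ M) {S : Finset V}
    (hS : ∀ v ∈ S, M ≤ 2 * closedNbhdSum G w v) :
    S.card * M ≤ 4 * a * ∑ v, w v := by
  classical
  obtain ⟨f, hf⟩ := hG.exists_orientation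
  have hsplit : ∀ v, closedNbhdSum G w v ≤
      (a + 1) * L + ∑ i, ∑ u with f i u = v, w u := by
    intro v
    have h1 : ∑ u ∈ G.neighborFinset v, w u ≤
        ∑ i, w (f i v) + ∑ i, ∑ u with f i u = v, w u := by
      calc ∑ u ∈ G.neighborFinset v, w u
          ≤ ∑ u ∈ univ.image (fun i => f i v) ∪
              univ.biUnion fun i => univ.filter fun u => f i u = v, w u := by
            refine sum_le_sum_of_subset fun u hu => ?_
            rw [SimpleGraph.mem_neighborFinset] at hu
            rcases hf v u hu with ⟨i, hi⟩ | ⟨i, hi⟩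
            · exact mem_union_left _ (mem_image.2 ⟨i, mem_univ i, hi⟩)
            · exact mem_union_right _ (mem_biUnion.2 ⟨i, mem_univ i, by simpa using hi⟩)
        _ ≤ _ := (sum_union_le_add _ _ w).trans (add_le_add
            (sum_image_le_of_nonneg fun _ _ => Nat.zero_le _) (sum_biUnion_le_sum _ _ _))
    have h2 : ∑ i, w (f i v) ≤ a * L := by
      simpa using sum_le_card_nsmul univ (fun i => w (f i v)) L fun i _ => hw _
    have h3 := hw v
    unfold closedNbhdSum
    linarith
  -- The vertex and its out-neighbours weigh at most `(a + 1) * L ≤ 2 * a * L ≤ M / 4`.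
  have hin : ∀ v ∈ S, M ≤ 4 * ∑ i, ∑ u with f i u = v, w u := by
    intro v hv
    have h1 := hS v hv
    have h2 := hsplit v
    have h3 : L ≤ a * L := Nat.le_mul_of_pos_left _ ha
    linarith
  calc S.card * M = S.card • M := by rw [smul_eq_mul]
    _ ≤ ∑ v ∈ S, 4 * ∑ i, ∑ u with f i u = v, w u := card_nsmul_le_sum _ _ _ hin
    _ ≤ ∑ v, 4 * ∑ i, ∑ u with f i u = v, w u := sum_le_sum_of_subset (subset_univ _)
    _ = 4 * ∑ i : Fin a, ∑ u, w u := by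
        rw [← mul_sum, sum_comm]
        congr 1
        exact sum_congr rfl fun i _ => sum_fiberwise _ _ _
    _ = 4 * a * ∑ v, w v := by simp [mul_assoc]

end Weights

/-! ### The primal-dual iteration -/

section Dynamics

variable {V : Type*} [Fintype V] (G : SimpleGraph V) [DecidableRel G.Adj] (k : ℕ)

/-- The primal-dual iteration: pairs of the weight exponents and the set of chosen vertices. Vertices
with a half full closed neighbourhood are chosen, then undominated vertices double their weight. -/
noncomputable def primalDual : ℕ → (V → ℕ) × Set V
  | 0 => (fun _ => 0, ∅)
  | i + 1 =>
    open Classical in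
    let J := (primalDual i).2 ∪
      {v | 2 ^ k ≤ 2 * closedNbhdSum G (fun u => 2 ^ (primalDual i).1 u) v}
    (fun v => if v ∈ J ∨ ∃ u, G.Adj v u ∧ u ∈ J then (primalDual i).1 v
      else (primalDual i).1 v + 1, J)

/-- The weight exponents after `i` iterations. -/
noncomputable def weightExp (i : ℕ) : V → ℕ := (primalDual G k i).1

/-- The chosen vertices after `i` iterations. -/
noncomputable def chosen (i : ℕ) : Set V := (primalDual G k i).2

/-- `v` lies in the closed neighbourhood of the chosen vertices. -/
def IsCovered (i : ℕ) (v : V) : Prop :=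
  v ∈ chosen G k i ∨ ∃ u, G.Adj v u ∧ u ∈ chosen G k i

variable {G k}

theorem mem_chosen_succ {i : ℕ} {v : V} : v ∈ chosen G k (i + 1) ↔
    v ∈ chosen G k i ∨ 2 ^ k ≤ 2 * closedNbhdSum G (fun u => 2 ^ weightExp G k i u) v :=
  Iff.rfl

open Classical in
theorem weightExp_succ (i : ℕ) (v : V) : weightExp G k (i + 1) v =
    if IsCovered G k (i + 1) v then weightExp G k i v else weightExp G k i v + 1 := by
  simp only [weightExp, IsCovered, chosen, primalDual]
  congr

theorem chosen_subset_succ (i : ℕ) : chosen G k i ⊆ chosen G k (i + 1) :=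
  fun _ h => Or.inl h

theorem IsCovered.succ {i : ℕ} {v : V} (h : IsCovered G k i v) : IsCovered G k (i + 1) v :=
  h.imp (fun h => chosen_subset_succ i h) fun ⟨u, hu, h⟩ => ⟨u, hu, chosen_subset_succ i h⟩

theorem weightExp_le_succ (i : ℕ) (v : V) : weightExp G k i v ≤ weightExp G k (i + 1) v := by
  rw [weightExp_succ]; split <;> omega

theorem weightExp_succ_le (i : ℕ) (v : V) : weightExp G k (i + 1) v ≤ weightExp G k i v + 1 := by
  rw [weightExp_succ]; split <;> omega

theorem weightExp_le (i : ℕ) (v : V) : weightExp G k i v ≤ i := by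
  induction i with
  | zero => exact le_rfl
  | succ i ih => exact (weightExp_succ_le i v).trans (by omega)

/-- Coverage is permanent, so a vertex still uncovered has doubled every time. -/
theorem weightExp_eq_of_not_isCovered {i : ℕ} {v : V} (h : ¬ IsCovered G k i v) :
    weightExp G k i v = i := by
  induction i with
  | zero => rfl
  | succ i ih => rw [weightExp_succ, if_neg h, ih fun h' => h h'.succ]

theorem half_full_of_mem_chosen {i : ℕ} {v : V} (h : v ∈ chosen G k i) :
    2 ^ k ≤ 2 * closedNbhdSum G (fun u => 2 ^ weightExp G k i u) v := by
  induction i with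
  | zero => exact absurd h (Set.notMem_empty v)
  | succ i ih =>
    refine le_trans ((mem_chosen_succ.1 h).elim ih id) (Nat.mul_le_mul_left 2 ?_)
    exact closedNbhdSum_mono (fun u => Nat.pow_le_pow_right two_pos (weightExp_le_succ i u)) v

/-- Dual feasibility: around a chosen vertex all weights are frozen, and any other closed
neighbourhood was less than half full, so doubling cannot overflow it. -/
theorem closedNbhdSum_weightExp_le (hk : Fintype.card V ≤ 2 ^ k) (i : ℕ) (v : V) :
    closedNbhdSum G (fun u => 2 ^ weightExp G k i u) v ≤ 2 ^ k := by
  induction i with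
  | zero =>
    refine le_trans ?_ hk
    have : weightExp G k 0 = fun _ => 0 := rfl
    simp only [closedNbhdSum, this, pow_zero, sum_const, smul_eq_mul, mul_one,
      SimpleGraph.card_neighborFinset_eq_degree]
    have := G.degree_lt_card_verts v
    omega
  | succ i ih =>
    by_cases h : v ∈ chosen G k (i + 1)
    · have heq : ∀ u, (u = v ∨ G.Adj v u) → weightExp G k (i + 1) u = weightExp G k i u := by
        rintro u hu
        rw [weightExp_succ, if_pos]
        rcases hu with rfl | hu
        · exact Or.inl h
        · exact Or.inr ⟨v, hu.symm, h⟩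
      refine le_trans (le_of_eq ?_) ih
      simp only [closedNbhdSum]
      rw [heq v (Or.inl rfl)]
      congr 1
      exact sum_congr rfl fun u hu => by rw [heq u (Or.inr (by simpa using hu))]
    · have h1 : 2 * closedNbhdSum G (fun u => 2 ^ weightExp G k i u) v < 2 ^ k :=
        not_le.1 fun h' => h (mem_chosen_succ.2 (Or.inr h'))
      refine le_trans ?_ h1.le
      unfold closedNbhdSum
      rw [mul_add, mul_sum]
      have : ∀ u, 2 ^ weightExp G k (i + 1) u ≤ 2 * 2 ^ weightExp G k i u := fun u => by
        rw [← pow_succ']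
        exact Nat.pow_le_pow_right two_pos (weightExp_succ_le i u)
      exact add_le_add (this v) (sum_le_sum fun u _ => this u)

/-- The number of iterations, so that the final weights are of the order of `2 ^ k / a`. -/
def numIterations (k a : ℕ) : ℕ := k - (Nat.log 2 a + 4)

open Classical in
/-- The chosen and the uncovered vertices. -/
noncomputable def primalDualSet (G : SimpleGraph V) [DecidableRel G.Adj] (k r : ℕ) : Finset V :=
  univ.filter fun v => v ∈ chosen G k r ∨ ¬ IsCovered G k r v

theorem isDominatingSet_primalDualSet (r : ℕ) : IsDominatingSet G (primalDualSet G k r) := by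
  intro v
  by_cases h : IsCovered G k r v
  · rcases h with h | ⟨u, hu, h⟩
    · exact Or.inl (by simp [primalDualSet, h])
    · exact Or.inr ⟨u, by simp [primalDualSet, h], hu.symm⟩
  · exact Or.inl (by simp [primalDualSet, h])

theorem card_primalDualSet_le {a : ℕ} (ha : 1 ≤ a) (hG : HasArboricityAtMost G a)
    (hk : Fintype.card V ≤ 2 ^ k) {D : Finset V} (hD : IsDominatingSet G D) :
    (primalDualSet G k (numIterations k a)).card ≤ 20 * a * D.card := by
  classical
  set r := numIterations k a with hr
  set w : V → ℕ := fun u => 2 ^ weightExp G k r u with hw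
  have hlog : 2 ^ Nat.log 2 a ≤ a := Nat.pow_log_le_self 2 (by omega)
  have hlog' : a < 2 ^ (Nat.log 2 a + 1) := Nat.lt_pow_succ_log_self one_lt_two a
  have hsum : ∑ v, w v ≤ 2 ^ k * D.card :=
    sum_le_mul_card_of_isDominatingSet (closedNbhdSum_weightExp_le hk r) hD
  have hchosen : (univ.filter fun v => v ∈ chosen G k r).card * 2 ^ k ≤ 4 * a * ∑ v, w v := by
    -- If the subtraction in `numIterations` truncates, even unit weights may be too large for the
    -- half full bound, but then nothing has been chosen.
    rcases Nat.eq_zero_or_pos r with h0 | hpos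
    · rw [h0]
      simp [chosen, primalDual]
    · refine card_mul_le_of_half_full (L := 2 ^ r) ha hG
        (fun v => Nat.pow_le_pow_right two_pos (weightExp_le r v)) ?_
        fun v hv => half_full_of_mem_chosen (by simpa using hv)
      have : k = (Nat.log 2 a + 1) + 3 + r := by
        unfold numIterations at hr
        omega
      rw [this, pow_add _ _ r, pow_add _ _ 3]
      refine Nat.mul_le_mul_right _ ?_
      omega
  have huncov : (univ.filter fun v => ¬ IsCovered G k r v).card * 2 ^ k ≤
      16 * a * ∑ v, w v := by
    have h1 : (univ.filter fun v => ¬ IsCovered G k r v).card * 2 ^ r ≤ ∑ v, w v := by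
      rw [← smul_eq_mul]
      refine (card_nsmul_le_sum _ w _ fun v hv => ?_).trans
        (sum_le_sum_of_subset (subset_univ _))
      simp only [hw]
      rw [weightExp_eq_of_not_isCovered (by simpa using hv)]
    -- Holds under truncation too, since always `k ≤ 4 + Nat.log 2 a + r`.
    have h2 : 2 ^ k ≤ 16 * a * 2 ^ r := by
      calc 2 ^ k ≤ 2 ^ (4 + Nat.log 2 a + r) :=
            Nat.pow_le_pow_right two_pos (by unfold numIterations at hr; omega)
        _ = 16 * 2 ^ Nat.log 2 a * 2 ^ r := by rw [pow_add, pow_add]; norm_num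
        _ ≤ 16 * a * 2 ^ r := by gcongr
    calc _ ≤ (univ.filter fun v => ¬ IsCovered G k r v).card * (16 * a * 2 ^ r) := by gcongr
      _ = 16 * a * ((univ.filter fun v => ¬ IsCovered G k r v).card * 2 ^ r) := by ring
      _ ≤ _ := by gcongr
  have hcard : (primalDualSet G k r).card ≤ (univ.filter fun v => v ∈ chosen G k r).card +
      (univ.filter fun v => ¬ IsCovered G k r v).card := by
    unfold primalDualSet
    rw [filter_or]
    exact card_union_le _ _
  refine Nat.le_of_mul_le_mul_right (c := 2 ^ k) ?_ (by positivity)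
  calc (primalDualSet G k r).card * 2 ^ k ≤ 20 * a * ∑ v, w v := by
        refine (Nat.mul_le_mul_right _ hcard).trans ?_
        rw [add_mul]
        linarith
    _ ≤ 20 * a * (2 ^ k * D.card) := by gcongr
    _ = _ := by ring

end Dynamics

/-! ### The message passing implementation -/

/-- The local state of a processor running the primal-dual algorithm. -/
structure PrimalDualState where
  /-- The binary logarithm of the capacity of a closed neighbourhood. -/
  capacity : ℕ
  /-- The number of rounds still to come. -/
  remaining : ℕ
  /-- The binary logarithm of the weight of the processor. -/
  exponent : ℕ
  /-- Whether the processor has been chosen. -/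
  isChosen : Bool
  /-- Whether the processor or a neighbour has been chosen. -/
  isCovered : Bool

namespace PrimalDualState

/-- The initial state of a processor. -/
def start (n a : ℕ) : PrimalDualState :=
  ⟨Nat.clog 2 n, 2 * numIterations (Nat.clog 2 n) a, 0, false, false⟩

/-- The message of a processor to all of its neighbours. -/
def broadcast (s : PrimalDualState) : List Bool :=
  if Even s.remaining then List.replicate s.exponent true else if s.isChosen then [true] else []

/-- The state after one round. -/
def next (s : PrimalDualState) (msgs : List (List Bool)) : PrimalDualState :=
  if Even s.remaining then
    { s with
      remaining := s.remaining - 1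
      -- An empty message contributes `2 ^ 0`, so exponent zero is correctly sent as silence.
      isChosen := s.isChosen ||
        decide (2 ^ s.capacity ≤ 2 * (2 ^ s.exponent + (msgs.map fun m => 2 ^ m.length).sum)) }
  else
    let covered := s.isChosen || msgs.any fun m => !m.isEmpty
    { s with
      remaining := s.remaining - 1
      isCovered := covered
      exponent := if covered then s.exponent else s.exponent + 1 }

end PrimalDualState

/-- The primal-dual algorithm. An iteration takes two rounds: first the weight exponents are
exchanged in unary, then the chosen processors announce themselves. -/
def primalDualAlgorithm : DistributedAlgorithm where
  State := PrimalDualState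
  init n a _ _ := .start n a
  send s _ := s.broadcast
  step s msgs := s.next msgs
  output s := if s.remaining = 0 then some (s.isChosen || !s.isCovered) else none

/-! ### Simulation of the iteration, message length and running time -/

section Correctness

variable {V : Type*} [Fintype V] {G : SimpleGraph V} [DecidableRel G.Adj]

/-- Since all ports carry the same message, the port numbering drops out. -/
theorem sum_map_inbox (A : DistributedAlgorithm) (N : Network G) (σ : V → A.State)
    (g : List Bool → ℕ) (m : V → List Bool) (hm : ∀ u p, A.emit (σ u) p = m u) (v : V) :
    ((A.inbox N σ v).map g).sum = ∑ u ∈ G.neighborFinset v, g (m u) := by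
  simp only [DistributedAlgorithm.inbox, hm, List.map_ofFn, List.sum_ofFn, Function.comp_apply]
  rw [Equiv.sum_comp (N.port v) fun u : G.neighborSet v => g (m u)]
  exact (sum_subtype _ (fun u => by simp) fun u => g (m u)).symm

theorem any_inbox_iff (A : DistributedAlgorithm) (N : Network G) (σ : V → A.State)
    (g : List Bool → Bool) (m : V → List Bool) (hm : ∀ u p, A.emit (σ u) p = m u) (v : V) :
    (A.inbox N σ v).any g = true ↔ ∃ u, G.Adj v u ∧ g (m u) = true := by
  simp only [DistributedAlgorithm.inbox, hm, List.any_eq_true, List.mem_ofFn]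
  constructor
  · rintro ⟨_, ⟨p, rfl⟩, h⟩
    exact ⟨N.port v p, (N.port v p).2, h⟩
  · rintro ⟨u, hu, h⟩
    exact ⟨_, ⟨(N.port v).symm ⟨u, hu⟩, by simp⟩, h⟩

theorem emit_primalDualAlgorithm (s : PrimalDualState) (p : ℕ) :
    primalDualAlgorithm.emit s p = if s.remaining = 0 then [] else s.broadcast := by
  by_cases h : s.remaining = 0 <;> simp [DistributedAlgorithm.emit, primalDualAlgorithm, h]

theorem output_of_remaining_eq_zero {s : PrimalDualState} (h : s.remaining = 0) :
    primalDualAlgorithm.output s = some (s.isChosen || !s.isCovered) :=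
  if_pos h

/-- The states in a run of the primal-dual algorithm. -/
def primalDualRun (N : Network G) (a t : ℕ) : V → PrimalDualState :=
  primalDualAlgorithm.stateAfter N a t

theorem primalDualRun_succ (N : Network G) (a t : ℕ) (v : V) :
    primalDualRun N a (t + 1) v = if (primalDualRun N a t v).remaining = 0
      then primalDualRun N a t v
      else (primalDualRun N a t v).next (primalDualAlgorithm.inbox N (primalDualRun N a t) v) := by
  have h : ∀ s : PrimalDualState, (primalDualAlgorithm.output s).isSome ↔ s.remaining = 0 := by
    intro s
    by_cases h : s.remaining = 0 <;> simp [primalDualAlgorithm, h]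
  exact if_congr (h _) rfl rfl

open Classical in
theorem primalDualRun_two_mul (N : Network G) {a k r i : ℕ}
    (hk : k = Nat.clog 2 (Fintype.card V)) (hr : r = numIterations k a) (hi : i ≤ r) (v : V) :
    primalDualRun N a (2 * i) v = ⟨k, 2 * (r - i), weightExp G k i v,
      decide (v ∈ chosen G k i), decide (IsCovered G k i v)⟩ := by
  induction i generalizing v with
  | zero =>
    have h0 : ∀ u : V, u ∉ chosen G k 0 := fun u => Set.notMem_empty u
    have h1 : ¬ IsCovered G k 0 v := by simp [IsCovered, h0]
    simp only [h0, h1, decide_false]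
    subst hk hr
    rfl
  | succ i ih =>
    obtain ⟨d, hd⟩ : ∃ d, r - i = d + 1 := ⟨r - i - 1, by omega⟩
    have hd' : r - (i + 1) = d := by omega
    have hodd : ¬ Even (2 * d + 1) := by simp
    have h0 := ih (by omega)
    rw [hd] at h0
    -- Halfway through an iteration only the chosen set has advanced.
    have h1 : ∀ u, primalDualRun N a (2 * i + 1) u = ⟨k, 2 * d + 1, weightExp G k i u,
        decide (u ∈ chosen G k (i + 1)), decide (IsCovered G k i u)⟩ := by
      intro u
      have hs := sum_map_inbox primalDualAlgorithm N (primalDualRun N a (2 * i))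
        (fun m => 2 ^ m.length) (fun u => List.replicate (weightExp G k i u) true)
        (fun u p => by
          rw [h0 u, emit_primalDualAlgorithm]
          simp [PrimalDualState.broadcast]) u
      simp only [List.length_replicate] at hs
      rw [primalDualRun_succ]
      generalize primalDualAlgorithm.inbox N (primalDualRun N a (2 * i)) u = msgs at hs ⊢
      rw [h0 u]
      have hmem := mem_chosen_succ (G := G) (k := k) (i := i) (v := u)
      rw [closedNbhdSum, ← hs] at hmem
      simp only [hmem]
      simp [PrimalDualState.next, show 2 * (d + 1) - 1 = 2 * d + 1 by omega]
    have hs := any_inbox_iff primalDualAlgorithm N (primalDualRun N a (2 * i + 1))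
      (fun m => !m.isEmpty) (fun u => if u ∈ chosen G k (i + 1) then [true] else [])
      (fun u p => by
        rw [h1 u, emit_primalDualAlgorithm]
        simp [PrimalDualState.broadcast, hodd]) v
    rw [hd', show 2 * (i + 1) = 2 * i + 1 + 1 by ring, primalDualRun_succ]
    generalize primalDualAlgorithm.inbox N (primalDualRun N a (2 * i + 1)) v = msgs at hs ⊢
    have hcov : (decide (v ∈ chosen G k (i + 1)) || msgs.any fun m => !m.isEmpty) =
        decide (IsCovered G k (i + 1) v) := by
      rw [Bool.eq_iff_iff, Bool.or_eq_true, hs, decide_eq_true_iff, decide_eq_true_iff]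
      refine or_congr Iff.rfl (exists_congr fun u => and_congr Iff.rfl ?_)
      by_cases h : u ∈ chosen G k (i + 1) <;> simp [h]
    rw [h1 v]
    simp only [PrimalDualState.next, hodd, if_false, hcov]
    simp [weightExp_succ]

/-- The exponent can grow only in odd rounds, exactly when the halved, rounded up count of remaining
rounds drops by one. -/
theorem exponent_add_remaining_le (N : Network G) (a t : ℕ) (v : V) :
    (primalDualRun N a t v).exponent + ((primalDualRun N a t v).remaining + 1) / 2 ≤
      numIterations (Nat.clog 2 (Fintype.card V)) a := by
  induction t with
  | zero =>
    change 0 + (2 * numIterations (Nat.clog 2 (Fintype.card V)) a + 1) / 2 ≤ _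
    omega
  | succ t ih =>
    rw [primalDualRun_succ]
    generalize primalDualAlgorithm.inbox N (primalDualRun N a t) v = msgs
    generalize primalDualRun N a t v = s at ih ⊢
    by_cases h0 : s.remaining = 0
    · simpa only [h0, if_true] using ih
    · rw [if_neg h0, PrimalDualState.next]
      by_cases h1 : Even s.remaining
      · have := Nat.even_iff.1 h1
        simp only [h1, if_true]
        omega
      · have := Nat.not_even_iff.1 h1
        simp only [h1, if_false]
        split <;> omega

theorem length_message_primalDualAlgorithm_le (N : Network G) (a t : ℕ) (v : V)
    (p : Fin (G.degree v)) : (primalDualAlgorithm.message N a t v p).length ≤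
      numIterations (Nat.clog 2 (Fintype.card V)) a := by
  have h := exponent_add_remaining_le N a t v
  have hm : primalDualAlgorithm.message N a t v p = _ :=
    emit_primalDualAlgorithm (primalDualRun N a t v) p
  rw [hm]
  generalize primalDualRun N a t v = s at h ⊢
  split
  · exact Nat.zero_le _
  · unfold PrimalDualState.broadcast
    -- The one-bit announcement fits because a running processor has `remaining ≥ 1`, which adds at
    -- least 1 on the left of `h`.
    split_ifs <;> simp only [List.length_replicate, List.length_cons, List.length_nil] <;> omega

theorem computesWithin_primalDualAlgorithm (N : Network G) (a : ℕ) :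
    primalDualAlgorithm.ComputesWithin N a
      (2 * numIterations (Nat.clog 2 (Fintype.card V)) a)
      (primalDualSet G (Nat.clog 2 (Fintype.card V))
        (numIterations (Nat.clog 2 (Fintype.card V)) a)) := by
  classical
  intro v
  have h := primalDualRun_two_mul N (a := a) rfl rfl le_rfl v
  rw [Nat.sub_self] at h
  refine ⟨_, (congrArg primalDualAlgorithm.output h).trans (output_of_remaining_eq_zero rfl), ?_⟩
  simp [primalDualSet]

end Correctness

/-- The offset of at least 4 absorbs the rounding up in `Nat.clog`, giving `2 ^ r ≤ n` for the
number `r` of iterations when `2 ≤ n`; then `1 / log 2 < 3`. For `n ≤ 1` both sides vanish. -/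
theorem numIterations_clog_le (n a : ℕ) :
    (numIterations (Nat.clog 2 n) a : ℝ) ≤ 3 * Real.log n := by
  rcases Nat.lt_or_ge n 2 with hn | hn
  · have : Nat.clog 2 n = 0 := Nat.clog_of_right_le_one (by omega) 2
    rw [this, numIterations, Nat.zero_sub, Nat.cast_zero]
    exact mul_nonneg (by norm_num) (Real.log_natCast_nonneg n)
  · have h1 : 2 ^ numIterations (Nat.clog 2 n) a ≤ n := by
      refine le_trans (Nat.pow_le_pow_right two_pos ?_) (Nat.pow_pred_clog_lt_self one_lt_two hn).le
      unfold numIterations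
      rw [Nat.pred_eq_sub_one]
      omega
    have h2 : (2 : ℝ) ^ numIterations (Nat.clog 2 n) a ≤ n := by exact_mod_cast h1
    have h3 := Real.log_le_log (by positivity) h2
    rw [Real.log_pow] at h3
    have h4 := Real.log_two_gt_d9
    have h5 : (0 : ℝ) ≤ numIterations (Nat.clog 2 n) a := Nat.cast_nonneg _
    nlinarith

/-- One deterministic CONGEST algorithm, with absolute constants in the number of rounds and in the
approximation factor. Identifiers come from `{0, …, n ^ c - 1}`, and messages have `O(log n)` bits,
where the constant depends only on `c`. -/
theorem theorem1 :
    ∃ (A : DistributedAlgorithm) (C : ℝ), ∀ c : ℕ, ∃ B : ℝ,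
      ∀ (V : Type*) [Fintype V] (G : SimpleGraph V) [DecidableRel G.Adj] (α : ℕ),
        1 ≤ α → HasArboricityAtMost G α →
        ∀ N : Network G, (∀ v, N.id v < Fintype.card V ^ c) →
          (∀ (t : ℕ) (v : V) (p : Fin (G.degree v)),
            ((A.message N α t v p).length : ℝ) ≤ B * Real.log (Fintype.card V)) ∧
          ∃ (T : ℕ) (S : Finset V),
            (T : ℝ) ≤ C * Real.log (Fintype.card V) ∧
            A.ComputesWithin N α T S ∧
            IsDominatingSet G S ∧
            ∀ D : Finset V, IsDominatingSet G D → (S.card : ℝ) ≤ C * (α : ℝ) ^ 2 * D.card := by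
  -- The 20 comes from the approximation factor; the `2 * r ≤ 6 * log n` rounds need less.
  refine ⟨primalDualAlgorithm, 20, fun _ => ⟨3, fun V _ G _ α hα hG N _ => ⟨fun t v p => ?_, ?_⟩⟩⟩
  · exact (Nat.cast_le.2 (length_message_primalDualAlgorithm_le N α t v p)).trans
      (numIterations_clog_le _ _)
  · refine ⟨_, _, ?_, computesWithin_primalDualAlgorithm N α, isDominatingSet_primalDualSet _,
      fun D hD => ?_⟩
    · have h := numIterations_clog_le (Fintype.card V) α
      have h0 := Real.log_natCast_nonneg (Fintype.card V)
      push_cast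
      linarith
    · have h := card_primalDualSet_le hα hG (Nat.le_pow_clog one_lt_two _) hD
      have h' : (α : ℝ) ≤ (α : ℝ) ^ 2 := le_self_pow₀ (by exact_mod_cast hα) two_ne_zero
      calc _ ≤ ((20 * α * D.card : ℕ) : ℝ) := Nat.cast_le.2 h
        _ = 20 * (α : ℝ) * D.card := by push_cast; ring
        _ ≤ 20 * (α : ℝ) ^ 2 * D.card := by gcongr
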